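/- Let $\mathbb{N}=\{1,2,3,\dots\}$, let $M$ be a commutative monoid (written additively), and let $\mu\colon M\times M\to M$ be a biadditive binary operation, i.e. $\mu(a+a',b)=\mu(a,b)+\mu(a',b)$ and $\mu(a,b+b')=\mu(a,b)+\mu(a,b')$ for all $a,a',b,b'\in M$ (it is not required that $\mu(0,b)=0$ or $\mu(a,0)=0$). For $a,b\in M$ write $a\lesssim b$ if there are $c,t\in M$ and $k\in\mathbb{N}$ with $ka+c+t=kb+t$. An element $s\in M$ is called $\mu$-localizable if, for all $a,b\in M$, each of the conditions $\mu(s,a)+a\lesssim\mu(s,b)+b$ and $\mu(a,s)+a\lesssim\mu(b,s)+b$ implies $a\lesssim b$. The monoid $M$ is called weakly $\mu$-localizable if for every $a\in M$ there is a $\mu$-localizable $s\in M$ with $a\lesssim s$. Let $\mathrm{Gr}(M)$ be the Grothendieck group of $M$ with canonical additive map $\iota\colon M\to\mathrm{Gr}(M)$. For a submonoid $S$ of an abelian group $G$ put $S^{\mathrm{up}}=\{a\in G : ka\in S\text{ for some }k\in\mathbb{N}\}$ and $S^{\ddagger}=\{a\in G : \text{there is } e\in G \text{ with } \ell a+e\in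 S\text{ for all }\ell\in\mathbb{N}\}$, and let $S^{\mathrm{up}\ddagger}=(S^{\mathrm{up}})^{\ddagger}$. The second reduced Grothendieck group of $M$ is the quotient group $$\nabla_2(M)=\mathrm{Gr}(M)\big/\bigl(\iota(M)^{\mathrm{up}\ddagger}\cap(-\iota(M)^{\mathrm{up}\ddagger})\bigr).$$ Let $\iota_2\colon M\to\nabla_2(M)$ be the composition of $\iota$ with the quotient map, and let $\mu_{\nabla,2}$ be the biadditive binary operation on $\nabla_2(M)$ induced by $\mu$, i.e. the unique biadditive binary operation on $\nabla_2(M)$ with $\mu_{\nabla,2}(\iota_2(a),\iota_2(b))=\iota_2(\mu(a,b))$ for all $a,b\in M$. If $M$ is weakly $\mu$-localizable, then $\mu_{\nabla,2}$ is associative and commutative. Thus the abelian group $\nabla_2(M)$ with multiplication $\mu_{\nabla,2}$ is a commutative (possibly non-unital) ring. -/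

import Mathlib

/-! ## The canonical quasi-order and localizability -/

/-- The canonical quasi-order of a commutative monoid:
`a ≲ b` if `k a + c + t = k b + t` for some `c, t ∈ M` and some integer `k ≥ 1`. -/
def CanLE {M : Type*} [AddCommMonoid M] (a b : M) : Prop :=
  ∃ (c t : M) (k : ℕ), 0 < k ∧ k • a + c + t = k • b + t

/-- A binary operation is biadditive if it preserves addition in each argument separately.
(It is not required to preserve `0`.) -/
structure IsBiadditive {M : Type*} [AddCommMonoid M] (μ : M → M → M) : Prop where
  add_left : ∀ a b c : M, μ (a + b) c = μ a c + μ b c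
  add_right : ∀ a b c : M, μ a (b + c) = μ a b + μ a c

/-- `s` is left `μ`-localizable. -/
def IsLeftLocalizable {M : Type*} [AddCommMonoid M] (μ : M → M → M) (s : M) : Prop :=
  ∀ a b : M, CanLE (μ s a + a) (μ s b + b) → CanLE a b

/-- `s` is `μ`-localizable: left localizable for `μ` and for the opposite operation of `μ`. -/
def IsLocalizable {M : Type*} [AddCommMonoid M] (μ : M → M → M) (s : M) : Prop :=
  IsLeftLocalizable μ s ∧ IsLeftLocalizable (fun a b => μ b a) s

/-- `M` is weakly `μ`-localizable. -/
def IsWeaklyLocalizable {M : Type*} [AddCommMonoid M] (μ : M → M → M) : Prop :=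
  ∀ a : M, ∃ s : M, IsLocalizable μ s ∧ CanLE a s

/-! ## The second reduced Grothendieck group -/

/-- `S^up`: all `a` with `k a ∈ S` for some integer `k ≥ 1`. -/
def AddSubmonoid.up {G : Type*} [AddCommGroup G] (S : AddSubmonoid G) : AddSubmonoid G where
  carrier := {a | ∃ k : ℕ, 0 < k ∧ k • a ∈ S}
  zero_mem' := ⟨1, one_pos, by simp⟩
  add_mem' := by
    rintro a b ⟨k, hk, ha⟩ ⟨l, hl, hb⟩
    refine ⟨k * l, Nat.mul_pos hk hl, ?_⟩
    rw [nsmul_add, mul_nsmul, mul_nsmul' b k l]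
    exact S.add_mem (S.nsmul_mem ha l) (S.nsmul_mem hb k)

/-- `S^‡`: all `a` for which there is `e ∈ G` with `ℓ a + e ∈ S` for all integers `ℓ ≥ 1`. -/
def AddSubmonoid.ddagger {G : Type*} [AddCommGroup G] (S : AddSubmonoid G) : AddSubmonoid G where
  carrier := {a | ∃ e : G, ∀ l : ℕ, 0 < l → l • a + e ∈ S}
  zero_mem' := ⟨0, fun l _ => by simp⟩
  add_mem' := by
    rintro a b ⟨e, he⟩ ⟨f, hf⟩
    refine ⟨e + f, fun l hl => ?_⟩
    rw [nsmul_add, add_add_add_comm]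
    exact S.add_mem (he l hl) (hf l hl)

/-- The image `ι(M)` of `M` in its Grothendieck group. -/
abbrev grothImage (M : Type*) [AddCommMonoid M] :
    AddSubmonoid (Algebra.GrothendieckAddGroup M) :=
  AddMonoidHom.mrange (Algebra.GrothendieckAddGroup.of (M := M))

/-- The subgroup `ι(M)^{up‡} ∩ (-ι(M)^{up‡})` of the Grothendieck group of `M`. -/
def redSndKer (M : Type*) [AddCommMonoid M] : AddSubgroup (Algebra.GrothendieckAddGroup M) :=
  (grothImage M).up.ddagger.support

/-- The second reduced Grothendieck group of `M`. -/
abbrev RedGrothSnd (M : Type*) [AddCommMonoid M] : Type _ :=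
  Algebra.GrothendieckAddGroup M ⧸ redSndKer M

/-- The canonical additive map from `M` to its second reduced Grothendieck group. -/
noncomputable def redSndOf (M : Type*) [AddCommMonoid M] : M →+ RedGrothSnd M :=
  (QuotientAddGroup.mk' (redSndKer M)).comp (Algebra.GrothendieckAddGroup.of (M := M))

/-! ## The induced operation -/

/-- An additive map from a commutative monoid to an abelian group automatically maps `0` to `0`. -/
def homOfAdditive {M G : Type*} [AddCommMonoid M] [AddCommGroup G] (f : M → G)
    (hf : ∀ a b, f (a + b) = f a + f b) : M →+ G where
  toFun := f
  map_zero' := by simpa using hf 0 0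
  map_add' := hf

theorem groth_lift_of {M G : Type*} [AddCommMonoid M] [AddCommGroup G] (f : M →+ G) (a : M) :
    Algebra.GrothendieckAddGroup.lift f (Algebra.GrothendieckAddGroup.of a) = f a :=
  DFunLike.congr_fun (Algebra.GrothendieckAddGroup.lift.symm_apply_apply f) a

theorem groth_hom_ext {M G : Type*} [AddCommMonoid M] [AddCommGroup G]
    {f g : Algebra.GrothendieckAddGroup M →+ G}
    (h : ∀ a : M, f (Algebra.GrothendieckAddGroup.of a) =
      g (Algebra.GrothendieckAddGroup.of a)) : f = g :=
  Algebra.GrothendieckAddGroup.lift.symm.injective (AddMonoidHom.ext h)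

/-- For fixed `a`, the extension of `μ(a, ·)` to the Grothendieck group. -/
noncomputable def grothMulLeft {M : Type*} [AddCommMonoid M] (μ : M → M → M)
    (hμ : IsBiadditive μ) (a : M) :
    Algebra.GrothendieckAddGroup M →+ Algebra.GrothendieckAddGroup M :=
  Algebra.GrothendieckAddGroup.lift <|
    homOfAdditive (fun b => Algebra.GrothendieckAddGroup.of (μ a b))
      (fun b c => by rw [hμ.add_right, map_add])

theorem grothMulLeft_of {M : Type*} [AddCommMonoid M] (μ : M → M → M) (hμ : IsBiadditive μ)
    (a b : M) :
    grothMulLeft μ hμ a (Algebra.GrothendieckAddGroup.of b) =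
      Algebra.GrothendieckAddGroup.of (μ a b) :=
  groth_lift_of _ _

/-- The biadditive operation induced by `μ` on the Grothendieck group; it satisfies
`ι(a) * ι(b) = ι(μ(a, b))`. -/
noncomputable def grothMul {M : Type*} [AddCommMonoid M] (μ : M → M → M) (hμ : IsBiadditive μ) :
    Algebra.GrothendieckAddGroup M →+
      Algebra.GrothendieckAddGroup M →+ Algebra.GrothendieckAddGroup M :=
  Algebra.GrothendieckAddGroup.lift <| homOfAdditive (grothMulLeft μ hμ) fun a b =>
    groth_hom_ext fun c => by
      rw [AddMonoidHom.add_apply, grothMulLeft_of, grothMulLeft_of, grothMulLeft_of,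
        hμ.add_left, map_add]

theorem grothMul_of {M : Type*} [AddCommMonoid M] (μ : M → M → M) (hμ : IsBiadditive μ) (a b : M) :
    grothMul μ hμ (Algebra.GrothendieckAddGroup.of a) (Algebra.GrothendieckAddGroup.of b) =
      Algebra.GrothendieckAddGroup.of (μ a b) :=
  (DFunLike.congr_fun (groth_lift_of _ a) _).trans (grothMulLeft_of μ hμ a b)

/-- Every element of the Grothendieck group is a difference of elements of the image of `M`. -/
theorem groth_exists_sub {M : Type*} [AddCommMonoid M] (x : Algebra.GrothendieckAddGroup M) :
    ∃ a b : M, x = Algebra.GrothendieckAddGroup.of a - Algebra.GrothendieckAddGroup.of b := by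
  obtain ⟨⟨a, b⟩, h⟩ := (AddLocalization.addMonoidOf (⊤ : AddSubmonoid M)).surj x
  exact ⟨a, b, eq_sub_of_add_eq h⟩

/-- An endomorphism of the Grothendieck group that preserves `ι(M)` preserves
`ι(M)^{up‡} ∩ (-ι(M)^{up‡})`. -/
theorem map_mem_redSndKer {M : Type*} [AddCommMonoid M]
    (f : Algebra.GrothendieckAddGroup M →+ Algebra.GrothendieckAddGroup M)
    (hf : ∀ x ∈ grothImage M, f x ∈ grothImage M) {x : Algebra.GrothendieckAddGroup M}
    (hx : x ∈ redSndKer M) : f x ∈ redSndKer M := by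
  have key : ∀ y ∈ (grothImage M).up.ddagger, f y ∈ (grothImage M).up.ddagger := by
    rintro y ⟨e, he⟩
    refine ⟨f e, fun l hl => ?_⟩
    obtain ⟨k, hk, h⟩ := he l hl
    refine ⟨k, hk, ?_⟩
    have h' := hf _ h
    rwa [map_nsmul, map_add, map_nsmul] at h'
  refine ⟨key x hx.1, ?_⟩
  have h' := key (-x) hx.2
  rwa [map_neg] at h'

theorem grothMul_mem_right {M : Type*} [AddCommMonoid M] (μ : M → M → M) (hμ : IsBiadditive μ)
    (x : Algebra.GrothendieckAddGroup M) {y : Algebra.GrothendieckAddGroup M}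
    (hy : y ∈ redSndKer M) : grothMul μ hμ x y ∈ redSndKer M := by
  obtain ⟨a, b, rfl⟩ := groth_exists_sub x
  have key : ∀ c : M,
      grothMul μ hμ (Algebra.GrothendieckAddGroup.of c) y ∈ redSndKer M := fun c =>
    map_mem_redSndKer _ (by
      rintro _ ⟨d, rfl⟩
      exact ⟨μ c d, (grothMul_of μ hμ c d).symm⟩) hy
  rw [map_sub, AddMonoidHom.sub_apply]
  exact sub_mem (key a) (key b)

theorem grothMul_mem_left {M : Type*} [AddCommMonoid M] (μ : M → M → M) (hμ : IsBiadditive μ)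
    {x : Algebra.GrothendieckAddGroup M} (hx : x ∈ redSndKer M)
    (y : Algebra.GrothendieckAddGroup M) : grothMul μ hμ x y ∈ redSndKer M := by
  obtain ⟨a, b, rfl⟩ := groth_exists_sub y
  have key : ∀ c : M,
      grothMul μ hμ x (Algebra.GrothendieckAddGroup.of c) ∈ redSndKer M := fun c =>
    map_mem_redSndKer ((grothMul μ hμ).flip (Algebra.GrothendieckAddGroup.of c)) (by
      rintro _ ⟨d, rfl⟩
      exact ⟨μ d c, (grothMul_of μ hμ d c).symm⟩) hx
  rw [map_sub]
  exact sub_mem (key a) (key b)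

/-- The biadditive operation `μ_{∇,2}` induced by `μ` on the second reduced Grothendieck group:
`[x] * [y] = [x * y]` for the induced operation on the Grothendieck group. -/
noncomputable def redSndMul {M : Type*} [AddCommMonoid M] (μ : M → M → M) (hμ : IsBiadditive μ) :
    RedGrothSnd M → RedGrothSnd M → RedGrothSnd M :=
  Quotient.map₂ (fun x y => grothMul μ hμ x y) fun x x' hx y y' hy => by
    have hx' : -x + x' ∈ redSndKer M := QuotientAddGroup.leftRel_apply.mp hx
    have hy' : -y + y' ∈ redSndKer M := QuotientAddGroup.leftRel_apply.mp hy
    refine QuotientAddGroup.leftRel_apply.mpr ?_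
    have h := add_mem (grothMul_mem_left μ hμ hx' y) (grothMul_mem_right μ hμ x' hy')
    simp only [map_add, map_neg, AddMonoidHom.add_apply, AddMonoidHom.neg_apply] at h
    convert h using 1
    abel

/-- `μ_{∇,2}` is the unique biadditive operation with
`μ_{∇,2}(ι₂(a), ι₂(b)) = ι₂(μ(a, b))` for all `a, b ∈ M`. -/
theorem redSndMul_unique {M : Type*} [AddCommMonoid M] (μ : M → M → M) (hμ : IsBiadditive μ)
    (ν : RedGrothSnd M → RedGrothSnd M → RedGrothSnd M) :
    (IsBiadditive ν ∧ ∀ a b : M, ν (redSndOf M a) (redSndOf M b) = redSndOf M (μ a b)) ↔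
      ν = redSndMul μ hμ := by
  constructor
  · rintro ⟨hν, h⟩
    have neg_left : ∀ x y, ν (-x) y = -ν x y := fun x y =>
      map_neg (homOfAdditive (fun x => ν x y) (fun a b => hν.add_left a b y)) x
    have neg_right : ∀ x y, ν x (-y) = -ν x y := fun x y =>
      map_neg (homOfAdditive (ν x) (hν.add_right x)) y
    funext x y
    induction x using QuotientAddGroup.induction_on with | H x => ?_
    induction y using QuotientAddGroup.induction_on with | H y => ?_
    obtain ⟨a, b, rfl⟩ := groth_exists_sub x
    obtain ⟨c, d, rfl⟩ := groth_exists_sub y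
    have e : ∀ a b : M, ((Algebra.GrothendieckAddGroup.of a - Algebra.GrothendieckAddGroup.of b :
        Algebra.GrothendieckAddGroup M) : RedGrothSnd M) = redSndOf M a + -redSndOf M b :=
      fun a b => by rw [← sub_eq_add_neg]; rfl
    have e' : redSndMul μ hμ
        ((Algebra.GrothendieckAddGroup.of a - Algebra.GrothendieckAddGroup.of b :
          Algebra.GrothendieckAddGroup M) : RedGrothSnd M)
        ((Algebra.GrothendieckAddGroup.of c - Algebra.GrothendieckAddGroup.of d :
          Algebra.GrothendieckAddGroup M) : RedGrothSnd M) =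
        redSndOf M (μ a c) - redSndOf M (μ b c) - (redSndOf M (μ a d) - redSndOf M (μ b d)) := by
      change ((grothMul μ hμ _ _ : Algebra.GrothendieckAddGroup M) : RedGrothSnd M) = _
      rw [map_sub, map_sub, AddMonoidHom.sub_apply, AddMonoidHom.sub_apply,
        grothMul_of, grothMul_of, grothMul_of, grothMul_of]
      rfl
    rw [e', e, e, hν.add_left, hν.add_right, hν.add_right, neg_left, neg_left, neg_right,
      neg_right, h, h, h, h]
    abel
  · rintro rfl
    refine ⟨⟨?_, ?_⟩, ?_⟩
    · rintro ⟨x⟩ ⟨y⟩ ⟨z⟩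
      exact congrArg (QuotientAddGroup.mk' (redSndKer M))
        (DFunLike.congr_fun (map_add (grothMul μ hμ) x y) z)
    · rintro ⟨x⟩ ⟨y⟩ ⟨z⟩
      exact congrArg (QuotientAddGroup.mk' (redSndKer M)) (map_add (grothMul μ hμ x) y z)
    · intro a b
      exact congrArg (QuotientAddGroup.mk' (redSndKer M)) (grothMul_of μ hμ a b)

/-! ## Extension of positive additive functionals -/

/-! Order the Grothendieck group by the cone `P = ι(M)^up`. By `canLE_iff`, `≲` is this order, so
localizability of `s` says that `1 + L` reflects positivity for `L` left or right multiplication by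
`s`. It must be shown that commutators and associators lie in `P^‡ ∩ -P^‡`.

Inside the order ideal of a positive `e`, Krein–Milman and a Hahn–Banach argument
(`nsmul_add_unit_mem`) reduce this to vanishing under every extreme state `f`. The crux is
`extreme_eigen`: since `1 + L` reflects positivity, `f` factors as `f₁ ∘ (1 + L)` with `f₁` positive
on a larger ideal (`AddSubmonoid.exists_nonneg_extension`). Then `f₁` and `f₁ ∘ A`, for `0 ≤ A ≤ L`,
are dominated by `f`, hence multiples of it by extremality. So, apart from a degenerate case, `f (A
x) = c * f x`: left and right multiplications by elements below `s` act as scalars under `f`.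
Scalars commute, which gives `associator_mem`; comparing the left and right scalars of `a` on `a`
itself gives `commutator_mem`. -/

/-- A real function on an abelian group is sublinear if it is subadditive and commutes with
multiplication by natural numbers. -/
structure IsSublinear {A : Type*} [AddCommGroup A] (p : A → ℝ) : Prop where
  add_le : ∀ x y, p (x + y) ≤ p x + p y
  nsmul : ∀ (n : ℕ) x, p (n • x) = n * p x

namespace IsSublinear

variable {A : Type*} [AddCommGroup A] {p q : A → ℝ}

theorem map_zero (hp : IsSublinear p) : p 0 = 0 := by
  simpa using hp.nsmul 0 0

theorem neg_neg_le (hp : IsSublinear p) (x : A) : -p (-x) ≤ p x := by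
  have h := hp.add_le x (-x)
  rw [add_neg_cancel, hp.map_zero] at h
  linarith

/-- The bound does not depend on `q`, so pointwise infima of such functions are finite. -/
theorem neg_le_of_le (hq : IsSublinear q) (h : q ≤ p) (x : A) : -p (-x) ≤ q x :=
  (neg_le_neg (h (-x))).trans (hq.neg_neg_le x)

/-- The infimum of a nonempty chain of sublinear functions with a common sublinear upper bound is
sublinear. -/
theorem iInf_chain {c : Set (A → ℝ)} (hc : IsChain (· ≤ ·) c) (hne : c.Nonempty)
    (hcs : ∀ q ∈ c, IsSublinear q ∧ q ≤ p) :
    IsSublinear (fun x => ⨅ q : c, q.1 x) := by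
  have : Nonempty c := hne.to_subtype
  have bdd : ∀ x, BddBelow (Set.range fun q : c => q.1 x) := fun x =>
    ⟨-p (-x), by rintro _ ⟨q, rfl⟩; exact (hcs q q.2).1.neg_le_of_le (hcs q q.2).2 x⟩
  refine ⟨fun x y => ?_, fun n x => ?_⟩
  · refine le_ciInf_add_ciInf fun q₁ q₂ => ?_
    rcases hc.total q₁.2 q₂.2 with h | h
    · exact (ciInf_le (bdd _) q₁).trans
        (((hcs _ q₁.2).1.add_le x y).trans (add_le_add le_rfl (h y)))
    · exact (ciInf_le (bdd _) q₂).trans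
        (((hcs _ q₂.2).1.add_le x y).trans (add_le_add (h x) le_rfl))
  · rw [Real.mul_iInf_of_nonneg n.cast_nonneg]
    exact iInf_congr fun q => (hcs q q.2).1.nsmul n x

/-- Lowering a sublinear function in the direction of `y`. -/
theorem iInf_translate (hp : IsSublinear p) (y : A) :
    IsSublinear (fun x => ⨅ n : ℕ, (p (x + n • y) - n * p y)) ∧
      (∀ x (n : ℕ), (⨅ n : ℕ, (p (x + n • y) - n * p y)) ≤ p (x + n • y) - n * p y) := by
  have bdd : ∀ x, BddBelow (Set.range fun n : ℕ => p (x + n • y) - n * p y) := fun x =>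
    ⟨-p (-x), by
      rintro _ ⟨n, rfl⟩
      have h := hp.add_le (x + n • y) (-x)
      rw [show x + n • y + -x = n • y by abel, hp.nsmul] at h
      dsimp only
      linarith⟩
  have le := fun x (n : ℕ) => ciInf_le (bdd x) n
  refine ⟨⟨fun x x' => ?_, fun k x => ?_⟩, le⟩
  · refine le_ciInf_add_ciInf fun m n => (le _ (m + n)).trans ?_
    have h := hp.add_le (x + m • y) (x' + n • y)
    rw [show x + m • y + (x' + n • y) = x + x' + (m + n) • y by rw [add_nsmul]; abel] at h
    push_cast
    linarith
  · rcases Nat.eq_zero_or_pos k with rfl | hk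
    · refine le_antisymm ?_ (le_ciInf fun n => ?_)
      · exact (le _ 0).trans (by simp [hp.map_zero])
      · simp [hp.nsmul]
    rw [Real.mul_iInf_of_nonneg k.cast_nonneg]
    refine le_antisymm (le_ciInf fun n => (le _ (k * n)).trans ?_) (le_ciInf fun n => ?_)
    · rw [mul_nsmul', ← nsmul_add, hp.nsmul]
      push_cast
      apply le_of_eq
      ring
    · refine (ciInf_le ⟨k * -p (-x), ?_⟩ n).trans ?_
      · rintro _ ⟨n, rfl⟩
        refine mul_le_mul_of_nonneg_left ?_ k.cast_nonneg
        have h := hp.add_le (x + n • y) (-x)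
        rw [show x + n • y + -x = n • y by abel, hp.nsmul] at h
        linarith
      -- With `k = j + 1`, subadditivity splits off `(j * n) • y` from `k • (x + n • y)`; its value
      -- `j * n * p y` is absorbed by the subtracted term.
      · obtain ⟨j, rfl⟩ := Nat.exists_eq_add_of_lt hk
        simp only [zero_add]
        have h := hp.add_le ((j + 1) • x + n • y) ((j * n) • y)
        rw [show (j + 1) • x + n • y + (j * n) • y = (j + 1) • (x + n • y) by
          rw [nsmul_add, ← mul_nsmul', add_assoc, ← add_nsmul]; congr 2; ring,
          hp.nsmul, hp.nsmul] at h
        push_cast at h ⊢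
        linarith

/-- Every sublinear function on an abelian group dominates an additive one. -/
theorem exists_addMonoidHom_le (hp : IsSublinear p) : ∃ f : A →+ ℝ, ∀ x, f x ≤ p x := by
  -- Zorn in the order dual yields a minimal sublinear function below `p`; minimality will force
  -- additivity.
  obtain ⟨q, hqp, hq⟩ := zorn_le_nonempty₀ (α := (A → ℝ)ᵒᵈ)
    {q | IsSublinear (OrderDual.ofDual q) ∧ OrderDual.ofDual q ≤ p}
    (fun c hcs hc q₀ hq₀ => by
      have hc' : IsChain (· ≤ ·) (show Set (A → ℝ) from c) := hc.symm
      have hcs' : ∀ q ∈ (show Set (A → ℝ) from c), IsSublinear q ∧ q ≤ p := fun q hq => hcs hq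
      have hle : ∀ q ∈ (show Set (A → ℝ) from c),
          (fun x => ⨅ q : (show Set (A → ℝ) from c), q.1 x) ≤ q := fun q hq x =>
        ciInf_le (f := fun q : (show Set (A → ℝ) from c) => q.1 x)
          ⟨-p (-x), by rintro _ ⟨q, rfl⟩; exact (hcs' q q.2).1.neg_le_of_le (hcs' q q.2).2 x⟩
          ⟨q, hq⟩
      exact ⟨OrderDual.toDual fun x => ⨅ q : (show Set (A → ℝ) from c), q.1 x,
        ⟨iInf_chain hc' ⟨q₀, hq₀⟩ hcs', (hle q₀ hq₀).trans (hcs' q₀ hq₀).2⟩, hle⟩)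
    (OrderDual.toDual p) ⟨hp, le_rfl⟩
  change A → ℝ at q
  have hsub : IsSublinear q := hq.prop.1
  have neg : ∀ y, q (-y) ≤ -q y := fun y => by
    obtain ⟨h₁, h₂⟩ := hsub.iInf_translate y
    have hle : (fun x => ⨅ n : ℕ, (q (x + n • y) - n * q y)) ≤ q := fun x => by
      simpa using h₂ x 0
    -- By minimality, lowering `q` in the direction `y` changes nothing; the term `n = 1` at `-y`
    -- then gives the claim.
    have hge := hq.le_of_ge (y := OrderDual.toDual fun x => ⨅ n : ℕ, (q (x + n • y) - n * q y))
      ⟨h₁, hle.trans hq.prop.2⟩ hle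
    have h := (hge (-y)).trans (h₂ (-y) 1)
    simpa [hsub.map_zero] using h
  refine ⟨AddMonoidHom.mk' q fun x y => le_antisymm (hsub.add_le x y) ?_, fun x => hq.prop.2 x⟩
  have h := hsub.add_le (x + y) (-y)
  rw [add_neg_cancel_right] at h
  linarith [neg y]

end IsSublinear

/-! The upper extension of an additive functional `g` along a homomorphism `h : B →+ A`
is `x ↦ inf {g b / n | n x ≤ h b}`. -/

namespace UpperExtension

variable {A B : Type*} [AddCommGroup A] [AddCommGroup B]
  (P : AddSubmonoid A) (h : B →+ A) (g : B →+ ℝ)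

/-- The pairs `(b, n)` with `n ≥ 1` and `n x ≤ h b`. -/
abbrev Index (x : A) : Type _ := {i : B × ℕ // 0 < i.2 ∧ h i.1 - i.2 • x ∈ P}

/-- The upper extension of `g` along `h`. -/
noncomputable def upper (x : A) : ℝ := ⨅ i : Index P h x, g i.1.1 / i.1.2

variable {P h g}

theorem nonempty_index (hcof : ∀ x, ∃ b, h b - x ∈ P) (x : A) : Nonempty (Index P h x) := by
  obtain ⟨b, hb⟩ := hcof x
  exact ⟨⟨(b, 1), one_pos, by rwa [one_nsmul]⟩⟩

/-- If `-x ≤ h b'` and `n x ≤ h b`, then `b + n b'` has positive image, so `g b / n ≥ -g b'`. -/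
theorem bddBelow_range (hpos : ∀ b, h b ∈ P → 0 ≤ g b) (hcof : ∀ x, ∃ b, h b - x ∈ P) (x : A) :
    BddBelow (Set.range fun i : Index P h x => g i.1.1 / i.1.2) := by
  obtain ⟨b', hb'⟩ := hcof (-x)
  refine ⟨-g b', ?_⟩
  rintro _ ⟨⟨⟨b, n⟩, hn, hb⟩, rfl⟩
  have h0 := hpos (b + n • b') (by
    have e : h (b + n • b') = h b - n • x + n • (h b' - -x) := by
      rw [map_add, map_nsmul]
      module
    rw [e]
    exact P.add_mem hb (P.nsmul_mem hb' n))
  rw [map_add, map_nsmul, nsmul_eq_mul] at h0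
  rw [le_div_iff₀ (Nat.cast_pos.2 hn)]
  dsimp only
  linarith

theorem upper_le (hpos : ∀ b, h b ∈ P → 0 ≤ g b) (hcof : ∀ x, ∃ b, h b - x ∈ P) {x : A} {b : B}
    {n : ℕ} (hn : 0 < n) (hb : h b - n • x ∈ P) : upper P h g x ≤ g b / n :=
  ciInf_le (bddBelow_range hpos hcof x) ⟨(b, n), hn, hb⟩

theorem upper_le_one (hpos : ∀ b, h b ∈ P → 0 ≤ g b) (hcof : ∀ x, ∃ b, h b - x ∈ P) {x : A}
    {b : B} (hb : h b - x ∈ P) : upper P h g x ≤ g b := by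
  have := upper_le hpos hcof (n := 1) one_pos (by rwa [one_nsmul])
  rwa [Nat.cast_one, div_one] at this

/-- Pairs `(b, n)` for `x` and `(b', n')` for `y` combine over the common denominator `n n'`. -/
theorem upper_add_le (hpos : ∀ b, h b ∈ P → 0 ≤ g b) (hcof : ∀ x, ∃ b, h b - x ∈ P) (x y : A) :
    upper P h g (x + y) ≤ upper P h g x + upper P h g y := by
  have := nonempty_index hcof x
  have := nonempty_index hcof y
  refine le_ciInf_add_ciInf ?_
  rintro ⟨⟨b, n⟩, hn, hb⟩ ⟨⟨b', n'⟩, hn', hb'⟩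
  dsimp only at hn hb hn' hb'
  have h₁ : (n : ℝ) ≠ 0 := by positivity
  have h₂ : (n' : ℝ) ≠ 0 := by positivity
  have e : h (n' • b + n • b') - (n * n') • (x + y) =
      n' • (h b - n • x) + n • (h b' - n' • y) := by
    rw [map_add, map_nsmul, map_nsmul]
    module
  have hm : h (n' • b + n • b') - (n * n') • (x + y) ∈ P := by
    rw [e]
    exact P.add_mem (P.nsmul_mem hb n') (P.nsmul_mem hb' n)
  refine (upper_le hpos hcof (Nat.mul_pos hn hn') hm).trans (le_of_eq ?_)
  simp only [map_add, map_nsmul, nsmul_eq_mul]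
  push_cast
  field_simp

theorem upper_zero (hpos : ∀ b, h b ∈ P → 0 ≤ g b) (hcof : ∀ x, ∃ b, h b - x ∈ P) :
    upper P h g 0 = 0 := by
  have := nonempty_index hcof 0
  refine le_antisymm ?_ (le_ciInf ?_)
  · have := upper_le_one hpos hcof (x := 0) (b := 0) (by simp)
    rwa [map_zero] at this
  · rintro ⟨⟨b, n⟩, hn, hb⟩
    rw [nsmul_zero, sub_zero] at hb
    exact div_nonneg (hpos b hb) n.cast_nonneg

theorem upper_nsmul (hpos : ∀ b, h b ∈ P → 0 ≤ g b) (hcof : ∀ x, ∃ b, h b - x ∈ P) (k : ℕ)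
    (x : A) : upper P h g (k • x) = k * upper P h g x := by
  rcases Nat.eq_zero_or_pos k with rfl | hk
  · rw [zero_nsmul, upper_zero hpos hcof, Nat.cast_zero, zero_mul]
  have hk' : (0 : ℝ) < k := Nat.cast_pos.2 hk
  have := nonempty_index hcof x
  have := nonempty_index hcof (k • x)
  apply le_antisymm
  · rw [upper.eq_def P h g x, Real.mul_iInf_of_nonneg k.cast_nonneg]
    refine le_ciInf ?_
    rintro ⟨⟨b, n⟩, hn, hb⟩
    have e : h (k • b) - n • k • x = k • (h b - n • x) := by
      rw [map_nsmul]
      module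
    have hm : h (k • b) - n • k • x ∈ P := by
      rw [e]
      exact P.nsmul_mem hb k
    refine (upper_le hpos hcof hn hm).trans (le_of_eq ?_)
    rw [map_nsmul, nsmul_eq_mul, mul_div_assoc]
  · refine le_ciInf ?_
    rintro ⟨⟨b, n⟩, hn, hb⟩
    dsimp only at hn hb
    have h₁ := upper_le hpos hcof (x := x) (Nat.mul_pos hn hk) (by rwa [mul_nsmul'])
    have hn' : (0 : ℝ) < n := Nat.cast_pos.2 hn
    calc (k : ℝ) * upper P h g x ≤ k * (g b / (n * k : ℕ)) :=
          mul_le_mul_of_nonneg_left h₁ hk'.le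
      _ = g b / n := by
          push_cast
          field_simp

end UpperExtension

open UpperExtension in
/-- An additive functional on `B` which is nonnegative on the preimage of a cone `P` under a
homomorphism `h : B →+ A` with cofinal range extends along `h` to an additive functional
that is nonnegative on `P`. -/
theorem AddSubmonoid.exists_nonneg_extension {A B : Type*} [AddCommGroup A] [AddCommGroup B]
    (P : AddSubmonoid A) (h : B →+ A) (g : B →+ ℝ) (hpos : ∀ b, h b ∈ P → 0 ≤ g b)
    (hcof : ∀ x, ∃ b, h b - x ∈ P) :
    ∃ f : A →+ ℝ, (∀ x ∈ P, 0 ≤ f x) ∧ ∀ b, f (h b) = g b := by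
  have hp : IsSublinear (upper P h g) := ⟨upper_add_le hpos hcof, upper_nsmul hpos hcof⟩
  obtain ⟨f, hf⟩ := hp.exists_addMonoidHom_le
  have hle : ∀ b, f (h b) ≤ g b := fun b =>
    (hf _).trans (upper_le_one hpos hcof (by rw [sub_self]; exact P.zero_mem))
  refine ⟨f, fun x hx => ?_, fun b => le_antisymm (hle b) ?_⟩
  -- Positivity of `x` makes `b = 0` an upper bound of `-x`.
  · have h₁ := (hf (-x)).trans (upper_le_one hpos hcof (b := 0) (by simpa using hx))
    rw [map_neg, map_zero] at h₁
    linarith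
  · have h₁ := hle (-b)
    simp only [map_neg] at h₁
    linarith

/-! ## Extreme states -/

/-- The additive functionals that are nonnegative on `P` and normalized at `e`. -/
def stateSpace {A : Type*} [AddCommGroup A] (P : AddSubmonoid A) (e : A) : Set (A → ℝ) :=
  {f | (∀ x y, f (x + y) = f x + f y) ∧ (∀ x ∈ P, 0 ≤ f x) ∧ f e = 1}

section States

variable {A : Type*} [AddCommGroup A] {P : AddSubmonoid A} {e : A}

theorem AddMonoidHom.mem_stateSpace {f : A →+ ℝ} (h : ∀ x ∈ P, 0 ≤ f x) (he : f e = 1) :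
    (f : A → ℝ) ∈ stateSpace P e :=
  ⟨map_add f, h, he⟩

theorem exists_hom_of_mem_stateSpace {f : A → ℝ} (hf : f ∈ stateSpace P e) :
    ∃ F : A →+ ℝ, (F : A → ℝ) = f :=
  ⟨AddMonoidHom.mk' f hf.1, rfl⟩

theorem le_nsmul_unit {f : A →+ ℝ} (hf : ∀ x ∈ P, 0 ≤ f x) {x : A} {n : ℕ}
    (h : n • e - x ∈ P) : f x ≤ n * f e := by
  have := hf _ h
  rw [map_sub, map_nsmul, nsmul_eq_mul] at this
  linarith

theorem convex_stateSpace : Convex ℝ (stateSpace P e) := by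
  rintro f hf g hg a b ha hb hab
  refine ⟨fun x y => ?_, fun x hx => ?_, ?_⟩
  · simp only [Pi.add_apply, Pi.smul_apply, smul_eq_mul, hf.1, hg.1]
    ring
  · exact add_nonneg (mul_nonneg ha (hf.2.1 x hx)) (mul_nonneg hb (hg.2.1 x hx))
  · simp only [Pi.add_apply, Pi.smul_apply, smul_eq_mul, hf.2.2, hg.2.2, mul_one, hab]

/-- The order unit confines each value to a fixed interval, so Tychonoff applies; the defining
conditions are closed pointwise. -/
theorem isCompact_stateSpace (hunit : ∀ x, ∃ n : ℕ, n • e - x ∈ P) :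
    IsCompact (stateSpace P e) := by
  choose n hn using hunit
  refine (isCompact_univ_pi fun x : A =>
    isCompact_Icc (a := -(n (-x) : ℝ)) (b := n x)).of_isClosed_subset ?_ ?_
  · have h₁ : IsClosed {f : A → ℝ | ∀ x y, f (x + y) = f x + f y} := by
      simp only [Set.ofPred_forall]
      exact isClosed_iInter fun x => isClosed_iInter fun y =>
        isClosed_eq (continuous_apply _) ((continuous_apply x).add (continuous_apply y))
    have h₂ : IsClosed {f : A → ℝ | ∀ x ∈ P, 0 ≤ f x} := by
      simp only [Set.ofPred_forall]
      exact isClosed_iInter fun x => isClosed_iInter fun _ =>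
        isClosed_le continuous_const (continuous_apply _)
    exact h₁.inter (h₂.inter (isClosed_eq (continuous_apply e) continuous_const))
  · intro f hf x _
    obtain ⟨F, rfl⟩ := exists_hom_of_mem_stateSpace hf
    have h₁ := le_nsmul_unit hf.2.1 (hn x)
    have h₂ := le_nsmul_unit hf.2.1 (hn (-x))
    rw [hf.2.2, mul_one] at h₁ h₂
    rw [map_neg] at h₂
    exact ⟨by linarith, h₁⟩

/-- An element on which all extreme states vanish is infinitesimal. -/
theorem nsmul_add_unit_mem (hP : ∀ (k : ℕ) (x : A), 0 < k → k • x ∈ P → x ∈ P) (he : e ∈ P)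
    (hunit : ∀ x, ∃ n : ℕ, n • e - x ∈ P) {y : A}
    (hy : ∀ f ∈ (stateSpace P e).extremePoints ℝ, f y = 0) (l : ℕ) : l • y + e ∈ P := by
  by_contra hl
  -- Krein–Milman: vanishing at `y` is a closed convex condition.
  have hall : ∀ f ∈ stateSpace P e, f y = 0 := by
    have hcl : IsClosed {f : A → ℝ | f y = 0} :=
      isClosed_eq (continuous_apply y) continuous_const
    have hcv : Convex ℝ {f : A → ℝ | f y = 0} := by
      intro f hf g hg a b _ _ _
      simp only [Set.mem_ofPred_eq] at hf hg
      simp [hf, hg]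
    have := closure_minimal (convexHull_min hy hcv) hcl
    rwa [closure_convexHull_extremePoints (isCompact_stateSpace hunit) convex_stateSpace] at this
  -- Adjoin `-(l • y + e)` to the cone and extend `e ↦ 1` from the multiples of `e`. The resulting
  -- state is at most `0` at `l • y + e`, yet vanishing at `y` forces the value `1`.
  obtain ⟨f, hf, hfe⟩ := AddSubmonoid.exists_nonneg_extension
    (P ⊔ AddSubmonoid.multiples (-(l • y + e))) (zmultiplesHom A e) (Int.castAddHom ℝ)
    (fun m hm => by
      by_contra! hneg
      simp only [Int.coe_castAddHom] at hneg
      have hneg' : m < 0 := by exact_mod_cast hneg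
      obtain ⟨p, hp, q, ⟨n, rfl⟩, hpq⟩ := AddSubmonoid.mem_sup.1 hm
      obtain ⟨j, rfl⟩ : ∃ j : ℕ, m = -((j : ℤ) + 1) := ⟨(-m - 1).toNat, by omega⟩
      have e₁ : n • (l • y + e) = p + (j + 1) • e := by
        have h₁ : p + n • (-(l • y + e)) = (-((j : ℤ) + 1)) • e := hpq
        have h₂ : ((j + 1 : ℕ)) • e = ((j : ℤ) + 1) • e := by
          rw [← natCast_zsmul]; push_cast; rfl
        rw [h₂, ← neg_neg (((j : ℤ) + 1) • e), ← neg_smul, ← h₁]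
        module
      have e₂ : n • (l • y + e) ∈ P := e₁ ▸ P.add_mem hp (P.nsmul_mem he _)
      -- If the new generator is not used, then `-e ∈ P` and the order unit makes every element
      -- positive; otherwise `hP` divides by `n`.
      rcases Nat.eq_zero_or_pos n with rfl | hn
      · have hne : -e ∈ P := by
          have : -e = p + j • e := by
            rw [zero_nsmul, succ_nsmul, ← add_assoc] at e₁
            exact (eq_neg_of_add_eq_zero_left e₁.symm).symm
          rw [this]
          exact P.add_mem hp (P.nsmul_mem he _)
        obtain ⟨k, hk⟩ := hunit (-(l • y + e))
        apply hl
        have := P.add_mem hk (P.nsmul_mem hne k)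
        rwa [show k • e - -(l • y + e) + k • -e = l • y + e by module] at this
      · exact hl (hP n _ hn e₂))
    (fun x => by
      obtain ⟨n, hn⟩ := hunit x
      exact ⟨n, AddSubmonoid.mem_sup_left (by simpa using hn)⟩)
  have h1 : f e = 1 := by simpa using hfe 1
  have h0 := hall f (f.mem_stateSpace (fun x hx => hf x (AddSubmonoid.mem_sup_left hx)) h1)
  have h2 := hf _ (AddSubmonoid.mem_sup_right (AddSubmonoid.mem_multiples (-(l • y + e))))
  rw [map_neg, map_add, map_nsmul, h0, h1, smul_zero, zero_add] at h2
  linarith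

/-- A positive additive functional dominated by an extreme state is a multiple of it. -/
theorem eq_mul_of_le_extreme (he : e ∈ P) (hunit : ∀ x, ∃ n : ℕ, n • e - x ∈ P) {f : A → ℝ}
    (hf : f ∈ (stateSpace P e).extremePoints ℝ) (g : A →+ ℝ) (hg : ∀ x ∈ P, 0 ≤ g x)
    (hgf : ∀ x ∈ P, g x ≤ f x) (x : A) : g x = g e * f x := by
  obtain ⟨F, rfl⟩ := exists_hom_of_mem_stateSpace hf.1
  have hFe : F e = 1 := hf.1.2.2
  have zero : ∀ u : A →+ ℝ, (∀ x ∈ P, 0 ≤ u x) → u e = 0 → ∀ x, u x = 0 := by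
    intro u hu hue x
    obtain ⟨n, hn⟩ := hunit x
    obtain ⟨m, hm⟩ := hunit (-x)
    have h₁ := le_nsmul_unit hu hn
    have h₂ := le_nsmul_unit hu hm
    rw [hue, mul_zero] at h₁ h₂
    rw [map_neg] at h₂
    linarith
  have hge := hg e he
  have hge1 : g e ≤ 1 := hFe ▸ hgf e he
  rcases hge.eq_or_lt with h0 | h0
  · rw [zero g hg h0.symm, ← h0, zero_mul]
  rcases hge1.eq_or_lt with h1 | h1
  · have := zero (F - g) (fun x hx => by simpa using hgf x hx) (by simp [hFe, h1]) x
    rw [AddMonoidHom.sub_apply] at this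
    rw [h1]
    linarith
  have h1' : 0 < 1 - g e := by linarith
  -- For `0 < g e < 1`, `F` is a proper convex combination of the normalizations of `g` and `F - g`.
  have key := hf.2 (x₁ := fun x => (g e)⁻¹ * g x)
    ⟨fun x y => by simp only [map_add, mul_add],
      fun x hx => mul_nonneg (inv_nonneg.2 hge) (hg x hx), inv_mul_cancel₀ h0.ne'⟩
    (x₂ := fun x => (1 - g e)⁻¹ * (F x - g x))
    ⟨fun x y => by simp only [map_add]; ring,
      fun x hx => mul_nonneg (inv_nonneg.2 h1'.le) (sub_nonneg.2 (hgf x hx)), by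
        change (1 - g e)⁻¹ * (F e - g e) = 1
        rw [hFe, inv_mul_cancel₀ h1'.ne']⟩
    ⟨g e, 1 - g e, h0, h1', by ring, by
      funext x
      simp only [Pi.add_apply, Pi.smul_apply, smul_eq_mul]
      rw [mul_inv_cancel_left₀ h0.ne', mul_inv_cancel_left₀ h1'.ne']
      ring⟩
  have : (g e)⁻¹ * g x = F x := congrFun key x
  rw [← this, mul_inv_cancel_left₀ h0.ne']

end States

/-! ## Order ideals and dominated operators -/

/-- The order ideal generated by `e`. -/
def orderIdeal {G : Type*} [AddCommGroup G] (P : AddSubmonoid G) (e : G) : AddSubgroup G where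
  carrier := {x | ∃ n : ℕ, n • e - x ∈ P ∧ n • e + x ∈ P}
  zero_mem' := ⟨0, by simp⟩
  add_mem' := by
    rintro x y ⟨n, h₁, h₂⟩ ⟨m, h₃, h₄⟩
    refine ⟨n + m, ?_, ?_⟩
    · have := P.add_mem h₁ h₃
      rwa [show n • e - x + (m • e - y) = (n + m) • e - (x + y) by module] at this
    · have := P.add_mem h₂ h₄
      rwa [show n • e + x + (m • e + y) = (n + m) • e + (x + y) by module] at this
  neg_mem' := by
    rintro x ⟨n, h₁, h₂⟩
    exact ⟨n, by rwa [sub_neg_eq_add], by rwa [← sub_eq_add_neg]⟩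

section Operators

variable {G : Type*} [AddCommGroup G] {P : AddSubmonoid G} {e : G}

theorem mem_orderIdeal_of_le (he : e ∈ P) {x : G} (hx : x ∈ P) (h : e - x ∈ P) :
    x ∈ orderIdeal P e :=
  ⟨1, by rwa [one_nsmul], by rw [one_nsmul]; exact P.add_mem he hx⟩

/-- The cone of positive elements of an order ideal. -/
abbrev idealCone (P : AddSubmonoid G) (e : G) : AddSubmonoid (orderIdeal P e) :=
  P.comap (orderIdeal P e).subtype

/-- The generator of an order ideal. -/
def idealUnit (he : e ∈ P) : orderIdeal P e :=
  ⟨e, mem_orderIdeal_of_le he he (by rw [sub_self]; exact P.zero_mem)⟩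

theorem idealUnit_isUnit (he : e ∈ P) (x : orderIdeal P e) :
    ∃ n : ℕ, n • idealUnit he - x ∈ idealCone P e := by
  obtain ⟨n, h, -⟩ := x.2
  exact ⟨n, h⟩

/-- A positive endomorphism `A` maps the order ideal generated by `e` into the one generated by any
`d` above `A e`. -/
theorem map_mem_orderIdeal {A : G →+ G} (hA : ∀ p ∈ P, A p ∈ P) {d : G} (hd : d - A e ∈ P) {x : G}
    (hx : x ∈ orderIdeal P e) : A x ∈ orderIdeal P d := by
  obtain ⟨n, h₁, h₂⟩ := hx
  have h₃ := hA _ h₁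
  have h₄ := hA _ h₂
  rw [map_sub, map_nsmul] at h₃
  rw [map_add, map_nsmul] at h₄
  refine ⟨n, ?_, ?_⟩
  · have := P.add_mem (P.nsmul_mem hd n) h₃
    rwa [show n • (d - A e) + (n • A e - A x) = n • d - A x by module] at this
  · have := P.add_mem (P.nsmul_mem hd n) h₄
    rwa [show n • (d - A e) + (n • A e + A x) = n • d + A x by module] at this

/-- Let `L` be a positive endomorphism such that `1 + L` reflects positivity. Under an extreme
state, every positive endomorphism dominated by `L` acts as a scalar, unless the state vanishes
wherever `L` is defined. -/
theorem extreme_eigen {L : G →+ G} (hL : ∀ p ∈ P, L p ∈ P) (hinv : ∀ x, x + L x ∈ P → x ∈ P)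
    (he : e ∈ P) {f : orderIdeal P e → ℝ}
    (hf : f ∈ (stateSpace (idealCone P e) (idealUnit he)).extremePoints ℝ) :
    (∀ x y : orderIdeal P e, (y : G) = L x → f x = 0) ∨
      ∀ A : G →+ G, (∀ p ∈ P, A p ∈ P) → (∀ p ∈ P, L p - A p ∈ P) →
        ∃ c : ℝ, ∀ x y : orderIdeal P e, (y : G) = A x → f y = c * f x := by
  obtain ⟨F, rfl⟩ := exists_hom_of_mem_stateSpace hf.1
  have hI : ∀ x ∈ orderIdeal P e, x ∈ orderIdeal P (e + L e) := fun x hx =>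
    map_mem_orderIdeal (A := AddMonoidHom.id G) (fun p hp => hp) (by simpa using hL e he) hx
  have hAI : ∀ A : G →+ G, (∀ p ∈ P, A p ∈ P) → (∀ p ∈ P, L p - A p ∈ P) →
      ∀ x ∈ orderIdeal P e, A x ∈ orderIdeal P (e + L e) := fun A hA hLA x hx =>
    map_mem_orderIdeal hA (by rw [add_sub_assoc]; exact P.add_mem he (hLA e he)) hx
  have hLI := hAI L hL (fun p _ => by rw [sub_self]; exact P.zero_mem)
  let ι : orderIdeal P e →+ orderIdeal P (e + L e) := AddSubgroup.inclusion hI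
  let op : ∀ A : G →+ G, (∀ x ∈ orderIdeal P e, A x ∈ orderIdeal P (e + L e)) →
      (orderIdeal P e →+ orderIdeal P (e + L e)) := fun A hA =>
    (A.comp (orderIdeal P e).subtype).codRestrict _ fun x => hA x x.2
  -- Extension along `1 + L`: `hinv` gives positivity, and `n • e ↦ n • (e + L e)` gives cofinality.
  obtain ⟨f₁, hf₁, hext⟩ := AddSubmonoid.exists_nonneg_extension (idealCone P (e + L e))
    (ι + op L hLI) F (fun x hx => hf.1.2.1 x (hinv x hx)) (fun x => by
      obtain ⟨n, hn, -⟩ := x.2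
      refine ⟨n • idealUnit he, ?_⟩
      change ((n • e : G) + L (n • e)) - x ∈ P
      rwa [map_nsmul, ← nsmul_add])
  have hext' : ∀ x, f₁ (ι x) + f₁ (op L hLI x) = F x := fun x => by
    rw [← map_add]; exact hext x
  have hmul := fun g hg hgf => eq_mul_of_le_extreme (P := idealCone P e) (e := idealUnit he)
    (show idealUnit he ∈ idealCone P e from he) (idealUnit_isUnit he) hf g hg hgf
  have hι := hmul (f₁.comp ι) (fun x hx => hf₁ _ hx) (fun x hx => by
    have : 0 ≤ f₁ (op L hLI x) := hf₁ _ (hL _ hx)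
    have := hext' x
    simp only [AddMonoidHom.comp_apply]
    linarith)
  simp only [AddMonoidHom.comp_apply] at hι
  set r := f₁ (ι (idealUnit he)) with hr
  -- If `r = 0`, then `f₁` vanishes on the small ideal, hence so does `F x = f₁ (x + L x)` whenever
  -- `L x` stays in it.
  by_cases h0 : r = 0
  · left
    intro x y hy
    have e₁ : op L hLI x = ι y := Subtype.ext hy.symm
    rw [← hext' x, e₁, hι, hι, h0]
    ring
  · right
    intro A hA hLA
    have hA' := hmul (f₁.comp (op A (hAI A hA hLA))) (fun x hx => hf₁ _ (hA _ hx))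
      (fun x hx => by
        have h₁ : 0 ≤ f₁ (ι x) := hf₁ _ hx
        have h₂ : 0 ≤ f₁ (op L hLI x - op A (hAI A hA hLA) x) := hf₁ _ (hLA _ hx)
        have := hext' x
        rw [map_sub] at h₂
        simp only [AddMonoidHom.comp_apply]
        linarith)
    simp only [AddMonoidHom.comp_apply] at hA'
    refine ⟨r⁻¹ * f₁ (op A (hAI A hA hLA) (idealUnit he)), fun x y hy => ?_⟩
    have e₁ : op A (hAI A hA hLA) x = ι y := Subtype.ext hy.symm
    have h := hA' x
    rw [e₁, hι] at h
    rw [mul_assoc, ← h, inv_mul_cancel_left₀ h0]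

end Operators

/-! ## Infinitesimal commutators and associators -/

section Bilinear

variable {G : Type*} [AddCommGroup G] {P : AddSubmonoid G} {e : G}

theorem list_sum_mem_and_sub_mem {l : List G} (hl : ∀ x ∈ l, x ∈ P) :
    l.sum ∈ P ∧ ∀ x ∈ l, l.sum - x ∈ P := by
  refine ⟨P.list_sum_mem hl, fun x hx => ?_⟩
  obtain ⟨l₁, l₂, rfl⟩ := List.append_of_mem hx
  have := P.add_mem (P.list_sum_mem fun y (hy : y ∈ l₁) => hl y (by simp [hy]))
    (P.list_sum_mem fun y (hy : y ∈ l₂) => hl y (by simp [hy]))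
  rwa [List.sum_append, List.sum_cons,
    show l₁.sum + (x + l₂.sum) - x = l₁.sum + l₂.sum by abel]

/-- If all extreme states of an order ideal that contains the positive elements of a list and `z`
vanish on `z`, then `z` is in the largest subgroup of `P^‡`. -/
theorem mem_support_ddagger (hP : ∀ (k : ℕ) (x : G), 0 < k → k • x ∈ P → x ∈ P) (l : List G)
    (hl : ∀ x ∈ l, x ∈ P) (z : G)
    (h : ∀ (e : G) (he : e ∈ P), (∀ x ∈ l, x ∈ orderIdeal P e) →
      ∃ hz : z ∈ orderIdeal P e,
        ∀ f ∈ (stateSpace (idealCone P e) (idealUnit he)).extremePoints ℝ, f ⟨z, hz⟩ = 0) :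
    z ∈ P.ddagger.support := by
  obtain ⟨he, hle⟩ := list_sum_mem_and_sub_mem hl
  obtain ⟨hz, hfz⟩ := h l.sum he fun x hx => mem_orderIdeal_of_le he (hl x hx) (hle x hx)
  have key : ∀ y : orderIdeal P l.sum,
      (∀ f ∈ (stateSpace (idealCone P l.sum) (idealUnit he)).extremePoints ℝ, f y = 0) →
        (y : G) ∈ P.ddagger := fun y hy =>
    -- The generator of the ideal serves as the fixed translation for all multiples.
    ⟨l.sum, fun n _ => nsmul_add_unit_mem (P := idealCone P l.sum) (e := idealUnit he)
      (fun k x hk hx => hP k x hk hx) he (idealUnit_isUnit he) hy n⟩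
  refine ⟨key ⟨z, hz⟩ hfz, show -z ∈ P.ddagger from key (-⟨z, hz⟩) fun f hf => ?_⟩
  obtain ⟨F, rfl⟩ := exists_hom_of_mem_stateSpace hf.1
  rw [map_neg, hfz _ hf, neg_zero]

variable {m : G →+ G →+ G}

/-- Under an extreme state, multiplication by elements below `s` from the left acts as a scalar,
unless the state vanishes wherever multiplication by `s` is defined. -/
theorem extreme_mul_left (hm : ∀ x ∈ P, ∀ y ∈ P, m x y ∈ P) {s : G} (hs : s ∈ P)
    (hinv : ∀ x, x + m s x ∈ P → x ∈ P) (he : e ∈ P) {f : orderIdeal P e → ℝ}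
    (hf : f ∈ (stateSpace (idealCone P e) (idealUnit he)).extremePoints ℝ) :
    (∀ x (hx : x ∈ orderIdeal P e), m s x ∈ orderIdeal P e → f ⟨x, hx⟩ = 0) ∨
      ∀ a ∈ P, s - a ∈ P → ∃ c : ℝ, ∀ x (hx : x ∈ orderIdeal P e)
        (hax : m a x ∈ orderIdeal P e), f ⟨m a x, hax⟩ = c * f ⟨x, hx⟩ := by
  refine (extreme_eigen (hm s hs) hinv he hf).imp (fun h x hx hy => h ⟨x, hx⟩ ⟨_, hy⟩ rfl)
    fun h a ha hsa => ?_
  obtain ⟨c, hc⟩ := h (m a) (hm a ha) fun p hp => by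
    rw [← AddMonoidHom.sub_apply, ← map_sub]
    exact hm _ hsa p hp
  exact ⟨c, fun x hx hax => hc ⟨x, hx⟩ ⟨_, hax⟩ rfl⟩

/-- Commutators of elements with a common localizable upper bound are infinitesimal. -/
theorem commutator_mem (hP : ∀ (k : ℕ) (x : G), 0 < k → k • x ∈ P → x ∈ P)
    (hm : ∀ x ∈ P, ∀ y ∈ P, m x y ∈ P) {s : G} (hs : s ∈ P)
    (hleft : ∀ x, x + m s x ∈ P → x ∈ P) (hright : ∀ x, x + m x s ∈ P → x ∈ P)
    {a b : G} (ha : a ∈ P) (hb : b ∈ P) (hsa : s - a ∈ P) (hsb : s - b ∈ P) :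
    m a b - m b a ∈ P.ddagger.support := by
  have haa := hm a ha a ha
  have hab := hm a ha b hb
  have hba := hm b hb a ha
  -- `m a a` is needed to compare the left and right scalars of `a`; the products with `s` are
  -- needed for the degenerate alternatives of `extreme_mul_left`.
  refine mem_support_ddagger hP [a, b, m a a, m a b, m b a, m s (m a b), m s (m b a),
    m (m a b) s, m (m b a) s] ?_ _ fun e he hI => ?_
  · simp only [List.forall_mem_cons]
    exact ⟨ha, hb, haa, hab, hba, hm s hs _ hab, hm s hs _ hba, hm _ hab s hs, hm _ hba s hs,
      by simp⟩
  simp only [List.forall_mem_cons] at hI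
  obtain ⟨Ia, Ib, Iaa, Iab, Iba, Isab, Isba, Iabs, Ibas, -⟩ := hI
  refine ⟨sub_mem Iab Iba, fun f hf => ?_⟩
  obtain ⟨F, rfl⟩ := exists_hom_of_mem_stateSpace hf.1
  have hsub : F ⟨m a b - m b a, sub_mem Iab Iba⟩ = F ⟨_, Iab⟩ - F ⟨_, Iba⟩ :=
    map_sub F ⟨_, Iab⟩ ⟨_, Iba⟩
  rw [hsub]
  rcases extreme_mul_left hm hs hleft he hf with h | hl
  · rw [h _ Iab Isab, h _ Iba Isba, sub_zero]
  rcases extreme_mul_left (m := m.flip) (fun x hx y hy => hm y hy x hx) hs hright he hf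
    with h | hr
  · rw [h _ Iab Iabs, h _ Iba Ibas, sub_zero]
  obtain ⟨ca, hca⟩ := hl a ha hsa
  obtain ⟨cb, hcb⟩ := hl b hb hsb
  obtain ⟨da, hda⟩ := hr a ha hsa
  obtain ⟨db, hdb⟩ := hr b hb hsb
  have h₁ := hca b Ib Iab
  have h₂ : F ⟨m a b, Iab⟩ = db * F ⟨a, Ia⟩ := hdb a Ia Iab
  have h₃ := hcb a Ia Iba
  have h₄ : F ⟨m b a, Iba⟩ = da * F ⟨b, Ib⟩ := hda b Ib Iba
  have h₅ := hca a Ia Iaa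
  have h₆ : F ⟨m a a, Iaa⟩ = da * F ⟨a, Ia⟩ := hda a Ia Iaa
  -- Both products are multiples of `F a`. If `F a ≠ 0`, the two expressions for `F (m a a)` give
  -- `ca = da`, and both products equal `ca * F b`.
  by_cases h0 : F ⟨a, Ia⟩ = 0
  · rw [h₂, h₃, h0, mul_zero, mul_zero, sub_zero]
  · rw [h₁, h₄, mul_right_cancel₀ h0 (h₅.symm.trans h₆), sub_self]

/-- Associators whose outer elements have a common localizable upper bound are infinitesimal. -/
theorem associator_mem (hP : ∀ (k : ℕ) (x : G), 0 < k → k • x ∈ P → x ∈ P)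
    (hm : ∀ x ∈ P, ∀ y ∈ P, m x y ∈ P) {s : G} (hs : s ∈ P)
    (hleft : ∀ x, x + m s x ∈ P → x ∈ P) (hright : ∀ x, x + m x s ∈ P → x ∈ P)
    {a b c : G} (ha : a ∈ P) (hb : b ∈ P) (hc : c ∈ P) (hsa : s - a ∈ P)
    (hsc : s - c ∈ P) : m (m a b) c - m a (m b c) ∈ P.ddagger.support := by
  have hab := hm a ha b hb
  have hbc := hm b hb c hc
  have h1 := hm _ hab c hc
  have h2 := hm a ha _ hbc
  refine mem_support_ddagger hP [b, m a b, m b c, m (m a b) c, m a (m b c),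
    m s (m (m a b) c), m s (m a (m b c)), m (m (m a b) c) s, m (m a (m b c)) s] ?_ _
    fun e he hI => ?_
  · simp only [List.forall_mem_cons]
    exact ⟨hb, hab, hbc, h1, h2, hm s hs _ h1, hm s hs _ h2, hm _ h1 s hs, hm _ h2 s hs,
      by simp⟩
  simp only [List.forall_mem_cons] at hI
  obtain ⟨Ib, Iab, Ibc, I1, I2, Is1, Is2, I1s, I2s, -⟩ := hI
  refine ⟨sub_mem I1 I2, fun f hf => ?_⟩
  obtain ⟨F, rfl⟩ := exists_hom_of_mem_stateSpace hf.1
  have hsub : F ⟨m (m a b) c - m a (m b c), sub_mem I1 I2⟩ = F ⟨_, I1⟩ - F ⟨_, I2⟩ :=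
    map_sub F ⟨_, I1⟩ ⟨_, I2⟩
  rw [hsub]
  rcases extreme_mul_left hm hs hleft he hf with h | hl
  · rw [h _ I1 Is1, h _ I2 Is2, sub_zero]
  rcases extreme_mul_left (m := m.flip) (fun x hx y hy => hm y hy x hx) hs hright he hf
    with h | hr
  · rw [h _ I1 I1s, h _ I2 I2s, sub_zero]
  obtain ⟨ca, hca⟩ := hl a ha hsa
  obtain ⟨dc, hdc⟩ := hr c hc hsc
  have h₁ : F ⟨m (m a b) c, I1⟩ = dc * F ⟨_, Iab⟩ := hdc _ Iab I1
  have h₂ : F ⟨m b c, Ibc⟩ = dc * F ⟨b, Ib⟩ := hdc b Ib Ibc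
  -- Both bracketings evaluate to `ca * dc * F b`; no scalar for the middle factor is needed, so `b`
  -- need not lie below `s`.
  rw [h₁, hca b Ib Iab, hca _ Ibc I2, h₂]
  ring

end Bilinear

/-! ## The theorem -/

section Main

open Algebra.GrothendieckAddGroup

variable {M : Type*} [AddCommMonoid M]

theorem AddSubmonoid.mem_up_of_nsmul_mem {G : Type*} [AddCommGroup G] (S : AddSubmonoid G)
    (k : ℕ) (x : G) (hk : 0 < k) (h : k • x ∈ S.up) : x ∈ S.up := by
  obtain ⟨l, hl, h⟩ := h
  exact ⟨k * l, Nat.mul_pos hk hl, by rwa [mul_nsmul]⟩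

theorem of_mem_up (a : M) : of a ∈ (grothImage M).up :=
  ⟨1, one_pos, a, (one_nsmul _).symm⟩

/-- The summand `c` witnesses that `k (b - a)` comes from `M`, and `t` accounts for equality in the
Grothendieck group being equality in `M` up to a common summand. -/
theorem canLE_iff {a b : M} : CanLE a b ↔ of b - of a ∈ (grothImage M).up := by
  constructor
  · rintro ⟨c, t, k, hk, h⟩
    refine ⟨k, hk, c, ?_⟩
    have h' := congrArg (of (M := M)) h
    simp only [map_add, map_nsmul] at h'
    rw [nsmul_sub, eq_sub_iff_add_eq, add_comm]
    exact add_right_cancel h'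
  · rintro ⟨k, hk, c, h⟩
    have h' : of (k • a + c) = of (k • b) := by
      rw [map_add, h, nsmul_sub, map_nsmul, map_nsmul, add_sub_cancel]
    obtain ⟨t, ht⟩ := (AddLocalization.addMonoidOf (⊤ : AddSubmonoid M)).eq_iff_exists.1 h'
    exact ⟨c, t, k, hk, by rw [add_comm, ht, add_comm]⟩

variable {μ : M → M → M}

theorem grothMul_mem_up (hμ : IsBiadditive μ) {x y : Algebra.GrothendieckAddGroup M}
    (hx : x ∈ (grothImage M).up)
    (hy : y ∈ (grothImage M).up) : grothMul μ hμ x y ∈ (grothImage M).up := by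
  obtain ⟨k, hk, a, ha⟩ := hx
  obtain ⟨l, hl, b, hb⟩ := hy
  refine ⟨l * k, Nat.mul_pos hl hk, μ a b, ?_⟩
  rw [← grothMul_of μ hμ, ha, hb, map_nsmul, map_nsmul, AddMonoidHom.nsmul_apply, mul_nsmul']

/-- Writing `x` as a difference turns the condition on pairs into reflection of positivity by `1 +
L`, the form used by `extreme_eigen`. -/
theorem IsLocalizable.left (hμ : IsBiadditive μ) {s : M} (hs : IsLocalizable μ s)
    (x : Algebra.GrothendieckAddGroup M)
    (h : x + grothMul μ hμ (of s) x ∈ (grothImage M).up) : x ∈ (grothImage M).up := by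
  obtain ⟨b, a, rfl⟩ := groth_exists_sub x
  refine canLE_iff.1 (hs.1 a b (canLE_iff.2 ?_))
  convert h using 1
  rw [map_sub, grothMul_of, grothMul_of, map_add, map_add]
  abel

theorem IsLocalizable.right (hμ : IsBiadditive μ) {s : M} (hs : IsLocalizable μ s)
    (x : Algebra.GrothendieckAddGroup M)
    (h : x + grothMul μ hμ x (of s) ∈ (grothImage M).up) : x ∈ (grothImage M).up := by
  obtain ⟨b, a, rfl⟩ := groth_exists_sub x
  refine canLE_iff.1 (hs.2 a b (canLE_iff.2 ?_))
  convert h using 1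
  rw [map_sub, AddMonoidHom.sub_apply, grothMul_of, grothMul_of, map_add, map_add]
  abel

/-- Two elements of a weakly localizable monoid have a common localizable upper bound. -/
theorem IsWeaklyLocalizable.exists_upper (hloc : IsWeaklyLocalizable μ) (a b : M) :
    ∃ s, IsLocalizable μ s ∧ of s - of a ∈ (grothImage M).up ∧
      of s - of b ∈ (grothImage M).up := by
  -- Elements of `M` have positive images, so a bound of the sum bounds each summand.
  obtain ⟨s, hs, h⟩ := hloc (a + b)
  have h' := canLE_iff.1 h
  refine ⟨s, hs, ?_, ?_⟩
  · have := add_mem h' (of_mem_up b)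
    rwa [map_add, show of s - (of a + of b) + of b = of s - of a by abel] at this
  · have := add_mem h' (of_mem_up a)
    rwa [map_add, show of s - (of a + of b) + of a = of s - of b by abel] at this

theorem redSndOf_eq_iff {a b : M} : redSndOf M a = redSndOf M b ↔ of a - of b ∈ redSndKer M := by
  rw [← QuotientAddGroup.eq_iff_sub_mem]
  rfl

theorem redSndOf_comm (hμ : IsBiadditive μ) (hloc : IsWeaklyLocalizable μ) (a b : M) :
    redSndOf M (μ a b) = redSndOf M (μ b a) := by
  obtain ⟨s, hs, ha, hb⟩ := hloc.exists_upper a b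
  rw [redSndOf_eq_iff, ← grothMul_of μ hμ, ← grothMul_of μ hμ]
  exact commutator_mem (AddSubmonoid.mem_up_of_nsmul_mem _)
    (fun x hx y hy => grothMul_mem_up hμ hx hy) (of_mem_up s) (hs.left hμ) (hs.right hμ)
    (of_mem_up a) (of_mem_up b) ha hb

theorem redSndOf_assoc (hμ : IsBiadditive μ) (hloc : IsWeaklyLocalizable μ) (a b c : M) :
    redSndOf M (μ (μ a b) c) = redSndOf M (μ a (μ b c)) := by
  obtain ⟨s, hs, ha, hc⟩ := hloc.exists_upper a c
  rw [redSndOf_eq_iff, ← grothMul_of μ hμ, ← grothMul_of μ hμ, ← grothMul_of μ hμ a,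
    ← grothMul_of μ hμ b]
  exact associator_mem (AddSubmonoid.mem_up_of_nsmul_mem _)
    (fun x hx y hy => grothMul_mem_up hμ hx hy) (of_mem_up s) (hs.left hμ) (hs.right hμ)
    (of_mem_up a) (of_mem_up b) (of_mem_up c) ha hc

/-- Additive maps on the second reduced Grothendieck group that agree on the image of `M`
are equal. -/
theorem redSnd_hom_ext {H : Type*} [AddCommGroup H] {f g : RedGrothSnd M →+ H}
    (h : ∀ a, f (redSndOf M a) = g (redSndOf M a)) : f = g :=
  QuotientAddGroup.addMonoidHom_ext _ (groth_hom_ext h)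

variable (μ) in
/-- The induced operation as a biadditive map. -/
noncomputable def redSndMulHom (hμ : IsBiadditive μ) :
    RedGrothSnd M →+ RedGrothSnd M →+ RedGrothSnd M :=
  AddMonoidHom.mk' (fun x => AddMonoidHom.mk' (redSndMul μ hμ x)
    (((redSndMul_unique μ hμ _).2 rfl).1.add_right x))
    fun x y => AddMonoidHom.ext (((redSndMul_unique μ hμ _).2 rfl).1.add_left x y)

theorem redSndMulHom_of (hμ : IsBiadditive μ) (a b : M) :
    redSndMulHom μ hμ (redSndOf M a) (redSndOf M b) = redSndOf M (μ a b) :=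
  ((redSndMul_unique μ hμ _).2 rfl).2 a b

theorem redSndMulHom_comm (hμ : IsBiadditive μ) (hloc : IsWeaklyLocalizable μ)
    (x y : RedGrothSnd M) :
    redSndMulHom μ hμ x y = redSndMulHom μ hμ y x := by
  have : redSndMulHom μ hμ = (redSndMulHom μ hμ).flip :=
    redSnd_hom_ext fun a => redSnd_hom_ext fun b => by
      rw [AddMonoidHom.flip_apply, redSndMulHom_of, redSndMulHom_of, redSndOf_comm hμ hloc]
  exact DFunLike.congr_fun (DFunLike.congr_fun this x) y

theorem redSndMulHom_assoc (hμ : IsBiadditive μ) (hloc : IsWeaklyLocalizable μ)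
    (x y z : RedGrothSnd M) :
    redSndMulHom μ hμ (redSndMulHom μ hμ x y) z = redSndMulHom μ hμ x (redSndMulHom μ hμ y z) := by
  set m := redSndMulHom μ hμ with hm
  -- Associativity passes from the image of `M` to the whole group one variable at a time, since
  -- both sides are additive in each.
  have h₁ : ∀ a b z, m (m (redSndOf M a) (redSndOf M b)) z =
      m (redSndOf M a) (m (redSndOf M b) z) := fun a b z =>
    DFunLike.congr_fun (redSnd_hom_ext (f := m (m (redSndOf M a) (redSndOf M b)))
      (g := (m (redSndOf M a)).comp (m (redSndOf M b))) fun c => by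
        simp only [AddMonoidHom.comp_apply, hm, redSndMulHom_of, redSndOf_assoc hμ hloc]) z
  have h₂ : ∀ a y z, m (m (redSndOf M a) y) z = m (redSndOf M a) (m y z) := fun a y z =>
    DFunLike.congr_fun (redSnd_hom_ext (f := (m.flip z).comp (m (redSndOf M a)))
      (g := (m (redSndOf M a)).comp (m.flip z)) fun b => h₁ a b z) y
  exact DFunLike.congr_fun (redSnd_hom_ext (f := (m.flip z).comp (m.flip y))
    (g := m.flip (m y z)) fun a => h₂ a y z) x

end Main

theorem mainTheorem5 {M : Type*} [AddCommMonoid M] (μ : M → M → M) (hμ : IsBiadditive μ)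
    (hloc : IsWeaklyLocalizable μ) :
    (∀ x y z : RedGrothSnd M,
      redSndMul μ hμ (redSndMul μ hμ x y) z = redSndMul μ hμ x (redSndMul μ hμ y z)) ∧
    (∀ x y : RedGrothSnd M, redSndMul μ hμ x y = redSndMul μ hμ y x) ∧
    ∃ R : NonUnitalCommRing (RedGrothSnd M),
      R.toAddCommGroup = QuotientAddGroup.Quotient.addCommGroup (redSndKer M) ∧
      ∀ x y : RedGrothSnd M, R.mul x y = redSndMul μ hμ x y := by
  have hassoc : ∀ x y z : RedGrothSnd M,
      redSndMul μ hμ (redSndMul μ hμ x y) z = redSndMul μ hμ x (redSndMul μ hμ y z) :=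
    redSndMulHom_assoc hμ hloc
  have hcomm : ∀ x y : RedGrothSnd M, redSndMul μ hμ x y = redSndMul μ hμ y x :=
    redSndMulHom_comm hμ hloc
  refine ⟨hassoc, hcomm, ?_⟩
  exact ⟨{ QuotientAddGroup.Quotient.addCommGroup (redSndKer M) with
      mul := redSndMul μ hμ
      left_distrib := fun x y z => map_add (redSndMulHom μ hμ x) y z
      right_distrib := fun x y z => DFunLike.congr_fun (map_add (redSndMulHom μ hμ) x y) z
      zero_mul := fun x => DFunLike.congr_fun (map_zero (redSndMulHom μ hμ)) x
      mul_zero := fun x => map_zero (redSndMulHom μ hμ x)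
      mul_assoc := hassoc
      mul_comm := hcomm }, rfl, fun _ _ => rfl⟩
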